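/- **Corollary 3.3.** Let $V$ be a set and $\mathcal{I}\subseteq\mathcal{P}(V)$. Call $(V,\mathcal{I})$ an *interval system* if $\mathcal{I}$ is closed under arbitrary intersections (in particular $V\in\mathcal{I}$) and under unions of nonempty chains, and - (I$_0$) $\varnothing\in\mathcal{I}$ and $\{x\}\in\mathcal{I}$ for all $x\in V$; - (I$_1$) if $A,B\in\mathcal{I}$ and $A\cap B\neq\varnothing$, then $A\cup B\in\mathcal{I}$; - (I$_2$) if $A,B\in\mathcal{I}$, $A\cap B\neq\varnothing$, $A\nsubseteq B$ and $B\nsubseteq A$, then $A\setminus B\in\mathcal{I}$ (and $B\setminus A\in\mathcal{I}$). Let $\mathcal{D}(V,\mathcal{I})$ be the set of all partitions of $V$ whose blocks all belong to $\mathcal{I}$, ordered by refinement: $\pi_1\le\pi_2$ if and only if every block of $\pi_2$ is a union of blocks of $\pi_1$. This is a complete lattice. A *tolerance* of a lattice $L$ is a reflexive and symmetric relation $T\subseteq L^2$ compatible with $\vee$ and $\wedge$; a *block* of $T$ is a maximal set $B\subseteq L$ with $B^2\subseteq T$, and every block is a sublattice of $L$. The *skeleton tolerance* $\Sigma(L)$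 is the least tolerance of $L$ that contains all covering pairs $x\prec y$ of $L$. A lattice is *geometric* if it is complete, atomistic, semimodular (that is, $a\wedge b\prec a$ implies $b\prec a\vee b$) and algebraic. The lattice $L$ is *glued by geometric lattices* if every block of $\Sigma(L)$ is a geometric lattice. If $(V,\mathcal{I})$ is an interval system such that $\mathcal{D}(V,\mathcal{I})$ is finite, then $\mathcal{D}(V,\mathcal{I})$ is glued by geometric lattices. -/

import Mathlib

/-- A closure system on `V`: a family of subsets of `V` that is closed under arbitrary
intersections (the empty intersection being `V`). -/
structure ClosureSystem (V : Type*) where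
  closed : Set (Set V)
  sInter_mem : ∀ S : Set (Set V), S ⊆ closed → ⋂₀ S ∈ closed

/-- An interval system: an algebraic closure system satisfying (I₀), (I₁), (I₂). -/
structure IntervalSystem (V : Type*) extends ClosureSystem V where
  algebraic : ∀ C : Set (Set V), C ⊆ closed → C.Nonempty → IsChain (· ⊆ ·) C → ⋃₀ C ∈ closed
  empty_mem : ∅ ∈ closed
  singleton_mem : ∀ x : V, {x} ∈ closed
  union_mem : ∀ A ∈ closed, ∀ B ∈ closed, (A ∩ B).Nonempty → A ∪ B ∈ closed
  diff_mem : ∀ A ∈ closed, ∀ B ∈ closed, (A ∩ B).Nonempty → ¬ A ⊆ B → ¬ B ⊆ A →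
    A \ B ∈ closed

/-- The decompositions in a closure system: the partitions of `V` all of whose blocks are
closed. -/
def Decomposition {V : Type*} (Q : ClosureSystem V) : Type _ :=
  {π : Setoid.Partitions V // π.toSet ⊆ Q.closed}

namespace Decomposition

/-- Decompositions carry the refinement order of partitions; see `le_iff_blocks`. -/
instance {V : Type*} (Q : ClosureSystem V) : PartialOrder (Decomposition Q) :=
  inferInstanceAs (PartialOrder {π : Setoid.Partitions V // π.toSet ⊆ Q.closed})

/-- `π₁ ≤ π₂` if and only if every block of `π₂` is a union of blocks of `π₁`. -/
theorem le_iff_blocks {V : Type*} {Q : ClosureSystem V} (π₁ π₂ : Decomposition Q) :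
    π₁ ≤ π₂ ↔ ∀ B ∈ π₂.1.toSet, ∃ S ⊆ π₁.1.toSet, B = ⋃₀ S := by
  obtain ⟨⟨p, hp⟩, -⟩ := π₁
  obtain ⟨⟨q, hq⟩, -⟩ := π₂
  change (∀ {x y : V}, (∀ s ∈ p, x ∈ s → y ∈ s) → ∀ s ∈ q, x ∈ s → y ∈ s) ↔
    ∀ B ∈ q, ∃ S ⊆ p, B = ⋃₀ S
  constructor
  · intro h B hB
    refine ⟨{A | A ∈ p ∧ A ⊆ B}, fun A hA => hA.1, ?_⟩
    apply Set.Subset.antisymm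
    · intro x hx
      obtain ⟨A, ⟨hA, hxA⟩, -⟩ := hp.2 x
      refine ⟨A, ⟨hA, fun y hy => h (x := x) ?_ B hB hx⟩, hxA⟩
      intro s hs hxs
      rwa [Setoid.eq_of_mem_eqv_class hp.2 hs hxs hA hxA]
    · rintro x ⟨A, hA, hx⟩
      exact hA.2 hx
  · intro h x y hxy B hB hx
    obtain ⟨S, hS, rfl⟩ := h B hB
    obtain ⟨A, hA, hxA⟩ := hx
    exact ⟨A, hA, hxy A (hS hA) hxA⟩

/-- The equivalence relation whose classes are the blocks of a decomposition. -/
def toSetoid {V : Type*} {Q : ClosureSystem V} (π : Decomposition Q) : Setoid V :=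
  Setoid.mkClasses π.1.toSet π.1.isPartition.2

theorem setOf_toSetoid_mem {V : Type*} {Q : ClosureSystem V} (π : Decomposition Q) (y : V) :
    {x | π.toSetoid x y} ∈ Q.closed :=
  π.2 (Setoid.eqv_class_mem π.1.isPartition.2)

/-- The infimum of a set of decompositions is their infimum (common refinement) in the lattice of
all partitions. -/
instance {V : Type*} (Q : ClosureSystem V) : InfSet (Decomposition Q) where
  sInf P := ⟨Setoid.Partition.orderIso V (sInf (toSetoid '' P)), by
    rintro _ ⟨y, rfl⟩
    have h : {x | sInf (toSetoid '' P) x y} =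
        ⋂₀ ((fun π : Decomposition Q => {x | π.toSetoid x y}) '' P) := by
      ext x
      simp [Setoid.sInf_def]
    rw [h]
    apply Q.sInter_mem
    rintro _ ⟨π, -, rfl⟩
    exact π.setOf_toSetoid_mem y⟩

/-- The complete lattice `𝒟(V, 𝒬)` under the refinement order. -/
instance {V : Type*} (Q : ClosureSystem V) : CompleteLattice (Decomposition Q) :=
  completeLatticeOfInf (Decomposition Q) fun P => by
    have key : ∀ π : Decomposition Q, (Setoid.Partition.orderIso V) π.toSetoid = π.1 :=
      fun π => (Setoid.Partition.orderIso V).apply_symm_apply π.1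
    constructor
    · intro π hπ
      change (Setoid.Partition.orderIso V) (sInf (toSetoid '' P)) ≤ π.1
      rw [← key π, OrderIso.le_iff_le]
      exact sInf_le ⟨π, hπ, rfl⟩
    · intro σ hσ
      change σ.1 ≤ (Setoid.Partition.orderIso V) (sInf (toSetoid '' P))
      rw [← key σ, OrderIso.le_iff_le]
      refine le_sInf ?_
      rintro _ ⟨π, hπ, rfl⟩
      exact hσ hπ

end Decomposition

/-- A lattice is geometric if it is (complete and) atomistic, semimodular and algebraic. The
existential quantifier over `c` says that the given lattice is complete. -/
def IsGeometricLattice (L : Type*) [inst : Lattice L] : Prop :=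
  ∃ c : CompleteLattice L, c.toLattice = inst ∧
    @IsAtomistic L c.toPartialOrder c.toBoundedOrder.toOrderBot ∧
    @IsUpperModularLattice L c.toLattice ∧ @IsCompactlyGenerated L c

/-- A tolerance of a lattice: a reflexive, symmetric relation compatible with both
operations. -/
structure IsTolerance {L : Type*} [Lattice L] (T : L → L → Prop) : Prop where
  refl : ∀ a, T a a
  symm : ∀ a b, T a b → T b a
  sup : ∀ a b c d, T a b → T c d → T (a ⊔ c) (b ⊔ d)
  inf : ∀ a b c d, T a b → T c d → T (a ⊓ c) (b ⊓ d)

/-- A glued tolerance: one that contains all covering pairs. -/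
def IsGluedTolerance {L : Type*} [Lattice L] (T : L → L → Prop) : Prop :=
  IsTolerance T ∧ ∀ x y : L, x ⋖ y → T x y

/-- The skeleton tolerance `Σ(L)`: the intersection of all glued tolerances, that is the least
glued tolerance (see `isGluedTolerance_skeletonTolerance` and `skeletonTolerance_le`). -/
def skeletonTolerance (L : Type*) [Lattice L] (x y : L) : Prop :=
  ∀ T : L → L → Prop, IsGluedTolerance T → T x y

theorem isGluedTolerance_skeletonTolerance (L : Type*) [Lattice L] :
    IsGluedTolerance (skeletonTolerance L) :=
  ⟨⟨fun a _ hT => hT.1.refl a, fun a b h T hT => hT.1.symm a b (h T hT),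
    fun a b c d h h' T hT => hT.1.sup a b c d (h T hT) (h' T hT),
    fun a b c d h h' T hT => hT.1.inf a b c d (h T hT) (h' T hT)⟩,
    fun x y h _ hT => hT.2 x y h⟩

theorem skeletonTolerance_le {L : Type*} [Lattice L] {T : L → L → Prop}
    (hT : IsGluedTolerance T) {x y : L} (h : skeletonTolerance L x y) : T x y :=
  h T hT

/-- A block of a relation `T`: a maximal set `B` with `B × B ⊆ T`. -/
def IsToleranceBlock {L : Type*} (T : L → L → Prop) (B : Set L) : Prop :=
  Maximal (fun B : Set L => ∀ x ∈ B, ∀ y ∈ B, T x y) B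

/-- An element that is related to all members of a block belongs to the block. -/
theorem IsToleranceBlock.mem_of_forall {L : Type*} [Lattice L] {T : L → L → Prop}
    (hT : IsTolerance T) {B : Set L} (hB : IsToleranceBlock T B) {a : L}
    (ha : ∀ x ∈ B, T a x) : a ∈ B := by
  refine hB.2 (y := insert a B) ?_ (Set.subset_insert a B) (Set.mem_insert a B)
  rintro x (rfl | hx) y (rfl | hy)
  · exact hT.refl _
  · exact ha y hy
  · exact hT.symm _ _ (ha x hx)
  · exact hB.1 x hx y hy

/-- A block of a tolerance is a sublattice. -/
def IsToleranceBlock.toSublattice {L : Type*} [Lattice L] {T : L → L → Prop}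
    (hT : IsTolerance T) {B : Set L} (hB : IsToleranceBlock T B) : Sublattice L where
  carrier := B
  supClosed' := fun a ha b hb => hB.mem_of_forall hT fun x hx => by
    simpa using hT.sup a x b x (hB.1 a ha x hx) (hB.1 b hb x hx)
  infClosed' := fun a ha b hb => hB.mem_of_forall hT fun x hx => by
    simpa using hT.inf a x b x (hB.1 a ha x hx) (hB.1 b hb x hx)

/-- `L` is glued by geometric lattices: every block of its skeleton tolerance, with the lattice
structure inherited from `L`, is a geometric lattice. -/
def GluedByGeometricLattices (L : Type*) [Lattice L] : Prop :=
  ∀ (B : Set L) (hB : IsToleranceBlock (skeletonTolerance L) B),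
    IsGeometricLattice (hB.toSublattice (isGluedTolerance_skeletonTolerance L).1)

/-!
Write `x⁺` (`coverSup x`) for the join of `x` with all its covers in the lattice `L` of
decompositions. The proof shows that `x ⊔ y ≤ (x ⊓ y)⁺` defines a glued tolerance of `L`. It contains
the skeleton tolerance, so each block of the latter, being an interval `[a, b]`, has `b ≤ a⁺`; and
such intervals are geometric.

A cover of `x` is obtained by merging the blocks of `x` inside one interval `M` that is minimal among
the intervals made of at least two blocks of `x`. By minimality, any interval that meets two of the
blocks of `x` in `M` meets all of them (`exists_rel_of_covBy`), because intersections and, for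
intersecting intervals, unions are again intervals. Three facts follow.

* `L` is (upper) semimodular, so `x ↦ x⁺` is monotone (`coverSup_mono`).
* `x⁺ ⊓ z` is the join of the elements `p ⊓ z`, where `p` is `x` or a cover of `x`
  (`coverSup_inf_le`). Two points in one block of `x⁺` are joined by a path with steps in the blocks
  of covers of `x`; if both ends lie in a block `D` of `z`, the path can be moved into `D`
  (`rel_of_path`).
* `(x ⊓ y)⁺ = x⁺ ⊓ y⁺`: by the second fact this reduces to `p ⊓ q ≤ (x ⊓ y)⁺` for covers `p` of `x`
  and `q` of `y` (`inf_le_coverSup_inf`).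

Monotonicity and preservation of meets make the relation a tolerance. For `a ≤ s ≤ a⁺` the second
fact, with `z = s`, says that `s` is a join of covers of `a`, so `[a, b]` is atomistic; semimodularity
passes to intervals, and algebraicity is automatic in a finite lattice.
-/

/-! ### Intervals and decompositions -/

namespace IntervalSystem

variable {V : Type*} (I : IntervalSystem V)

/-- Intervals with a common point have an interval as their union, also when there are infinitely
many: an interval maximal inside the union contains each of them. -/
theorem sUnion_mem {F : Set (Set V)} {a : V} (hF : F ⊆ I.closed) (ha : ∀ A ∈ F, a ∈ A)
    (hne : F.Nonempty) : ⋃₀ F ∈ I.closed := by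
  obtain ⟨A₀, hA₀⟩ := hne
  obtain ⟨M, hM⟩ := zorn_subset {A | A ∈ I.closed ∧ a ∈ A ∧ A ⊆ ⋃₀ F} (by
    intro c hc hchain
    rcases c.eq_empty_or_nonempty with rfl | hne
    · exact ⟨A₀, ⟨hF hA₀, ha _ hA₀, Set.subset_sUnion_of_mem hA₀⟩, by simp⟩
    · obtain ⟨A, hA⟩ := hne
      exact ⟨⋃₀ c, ⟨I.algebraic c (fun B hB => (hc hB).1) ⟨A, hA⟩ hchain,
        ⟨A, hA, (hc hA).2.1⟩, Set.sUnion_subset fun B hB => (hc hB).2.2⟩,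
        fun B hB => Set.subset_sUnion_of_mem hB⟩)
  have hEq : M = ⋃₀ F := by
    refine hM.prop.2.2.antisymm (Set.sUnion_subset fun A hA => ?_)
    have h : M ∪ A ∈ {A | A ∈ I.closed ∧ a ∈ A ∧ A ⊆ ⋃₀ F} :=
      ⟨I.union_mem M hM.prop.1 A (hF hA) ⟨a, hM.prop.2.1, ha A hA⟩, Or.inl hM.prop.2.1,
        Set.union_subset hM.prop.2.2 (Set.subset_sUnion_of_mem hA)⟩
    exact Set.subset_union_right.trans (hM.le_of_ge h Set.subset_union_left)
  exact hEq ▸ hM.prop.1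

theorem inter_mem {A B : Set V} (hA : A ∈ I.closed) (hB : B ∈ I.closed) : A ∩ B ∈ I.closed := by
  rw [← Set.sInter_pair]
  exact I.sInter_mem _ (by rintro _ (rfl | rfl) <;> assumption)

end IntervalSystem

namespace Decomposition

section ClosureSystem

variable {V : Type*} {Q : ClosureSystem V}

theorem le_iff_toSetoid_le {x y : Decomposition Q} : x ≤ y ↔ x.toSetoid ≤ y.toSetoid :=
  ((Setoid.Partition.orderIso V).symm.le_iff_le (x := x.1) (y := y.1)).symm

theorem le_iff_rel {x y : Decomposition Q} :
    x ≤ y ↔ ∀ a b, x.toSetoid a b → y.toSetoid a b :=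
  le_iff_toSetoid_le.trans ⟨fun h _ _ hab => h hab, fun h _ _ hab => h _ _ hab⟩

/-- The decomposition into the classes of an equivalence relation all of whose classes are closed. -/
def ofSetoid (s : Setoid V) (h : ∀ a, {b | s b a} ∈ Q.closed) : Decomposition Q :=
  ⟨Setoid.Partition.orderIso V s, by rintro _ ⟨a, rfl⟩; exact h a⟩

@[simp] theorem toSetoid_ofSetoid (s : Setoid V) (h : ∀ a, {b | s b a} ∈ Q.closed) :
    (ofSetoid s h).toSetoid = s :=
  (Setoid.Partition.orderIso V).symm_apply_apply s

theorem class_mem (x : Decomposition Q) (a : V) : {b | x.toSetoid a b} ∈ Q.closed := by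
  have h := x.setOf_toSetoid_mem a
  simpa only [x.toSetoid.comm'] using h

end ClosureSystem

variable {V : Type*} {I : IntervalSystem V}

theorem inf_rel {x y : Decomposition I.toClosureSystem} {a b : V} :
    (x ⊓ y).toSetoid a b ↔ x.toSetoid a b ∧ y.toSetoid a b := by
  refine ⟨fun h => ⟨le_iff_rel.1 inf_le_left _ _ h, le_iff_rel.1 inf_le_right _ _ h⟩, fun h => ?_⟩
  let m : Decomposition I.toClosureSystem := ofSetoid (x.toSetoid ⊓ y.toSetoid)
    fun a => I.inter_mem (x.setOf_toSetoid_mem a) (y.setOf_toSetoid_mem a)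
  have hms : m.toSetoid = x.toSetoid ⊓ y.toSetoid := toSetoid_ofSetoid _ _
  have hm : m ≤ x ⊓ y := by
    refine le_inf ?_ ?_ <;> rw [le_iff_toSetoid_le, hms]
    exacts [inf_le_left, inf_le_right]
  refine le_iff_rel.1 hm _ _ ?_
  rw [hms]
  exact h

/-- The equivalence relation that merges all classes of `s` meeting `A` into one class. -/
def mergeSetoid (s : Setoid V) (A : Set V) : Setoid V where
  r a b := s a b ∨ (∃ c ∈ A, s a c) ∧ ∃ d ∈ A, s b d
  iseqv :=
    { refl := fun a => Or.inl (s.refl' a)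
      symm := by
        rintro a b (h | ⟨h, h'⟩)
        exacts [Or.inl (s.symm' h), Or.inr ⟨h', h⟩]
      trans := by
        rintro a b c (h | ⟨h, h'⟩) (k | ⟨k, k'⟩)
        · exact Or.inl (s.trans' h k)
        · obtain ⟨d, hd, hbd⟩ := k
          exact Or.inr ⟨⟨d, hd, s.trans' h hbd⟩, k'⟩
        · obtain ⟨d, hd, hbd⟩ := h'
          exact Or.inr ⟨h, d, hd, s.trans' (s.symm' k) hbd⟩
        · exact Or.inr ⟨h, k'⟩ }

theorem class_mergeSetoid_mem (x : Decomposition I.toClosureSystem) {A : Set V}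
    (hA : A ∈ I.closed) (a : V) : {b | mergeSetoid x.toSetoid A b a} ∈ I.closed := by
  by_cases h : ∃ c ∈ A, x.toSetoid a c
  · obtain ⟨c, hc, hac⟩ := h
    have hEq : {b | mergeSetoid x.toSetoid A b a} =
        ⋃₀ ((fun d => A ∪ {b | x.toSetoid b d}) '' A) := by
      ext b
      constructor
      · rintro (h | ⟨⟨d, hd, hbd⟩, -⟩)
        · exact ⟨_, ⟨c, hc, rfl⟩, Or.inr (x.toSetoid.trans' h hac)⟩
        · exact ⟨_, ⟨d, hd, rfl⟩, Or.inr hbd⟩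
      · rintro ⟨_, ⟨d, hd, rfl⟩, hb | hb⟩
        · exact Or.inr ⟨⟨b, hb, x.toSetoid.refl' b⟩, c, hc, hac⟩
        · exact Or.inr ⟨⟨d, hd, hb⟩, c, hc, hac⟩
    rw [hEq]
    refine I.sUnion_mem (a := c) ?_ ?_ ⟨_, c, hc, rfl⟩
    · rintro _ ⟨d, hd, rfl⟩
      exact I.union_mem _ hA _ (x.setOf_toSetoid_mem d) ⟨d, hd, x.toSetoid.refl' d⟩
    · rintro _ ⟨d, hd, rfl⟩
      exact Or.inl hc
  · have hEq : {b | mergeSetoid x.toSetoid A b a} = {b | x.toSetoid b a} := by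
      ext b
      exact ⟨fun hb => hb.resolve_right fun k => h k.2, Or.inl⟩
    rw [hEq]
    exact x.setOf_toSetoid_mem a

/-- The decomposition obtained from `x` by merging all blocks that meet the interval `A`. -/
def merge (x : Decomposition I.toClosureSystem) (A : Set V) (hA : A ∈ I.closed) :
    Decomposition I.toClosureSystem :=
  ofSetoid (mergeSetoid x.toSetoid A) (x.class_mergeSetoid_mem hA)

theorem merge_rel {x : Decomposition I.toClosureSystem} {A : Set V} {hA : A ∈ I.closed} {a b : V} :
    (x.merge A hA).toSetoid a b ↔
      x.toSetoid a b ∨ (∃ c ∈ A, x.toSetoid a c) ∧ ∃ d ∈ A, x.toSetoid b d := by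
  rw [merge, toSetoid_ofSetoid]
  rfl

theorem le_merge (x : Decomposition I.toClosureSystem) {A : Set V} (hA : A ∈ I.closed) :
    x ≤ x.merge A hA :=
  le_iff_rel.2 fun _ _ h => merge_rel.2 (Or.inl h)

theorem merge_rel_of_mem {x : Decomposition I.toClosureSystem} {A : Set V} (hA : A ∈ I.closed)
    {a b : V} (ha : a ∈ A) (hb : b ∈ A) : (x.merge A hA).toSetoid a b :=
  merge_rel.2 (Or.inr ⟨⟨a, ha, x.toSetoid.refl' a⟩, b, hb, x.toSetoid.refl' b⟩)

theorem merge_le {x y : Decomposition I.toClosureSystem} {A : Set V} (hA : A ∈ I.closed)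
    (hxy : x ≤ y) (h : ∀ a ∈ A, ∀ b ∈ A, y.toSetoid a b) : x.merge A hA ≤ y := by
  rw [le_iff_rel] at hxy ⊢
  intro a b hab
  rcases merge_rel.1 hab with hab | ⟨⟨c, hc, hac⟩, d, hd, hbd⟩
  · exact hxy _ _ hab
  · exact y.toSetoid.trans' (hxy _ _ hac)
      (y.toSetoid.trans' (h c hc d hd) (y.toSetoid.symm' (hxy _ _ hbd)))

theorem exists_rel_of_lt {x y : Decomposition I.toClosureSystem} (h : x < y) :
    ∃ a b, y.toSetoid a b ∧ ¬ x.toSetoid a b := by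
  by_contra! hc
  exact h.not_ge (le_iff_rel.2 hc)

theorem lt_of_rel {x y : Decomposition I.toClosureSystem} (h : x ≤ y) {a b : V}
    (hy : y.toSetoid a b) (hx : ¬ x.toSetoid a b) : x < y :=
  lt_of_le_of_ne h (by rintro rfl; exact hx hy)

/-- A cover `p` of `x` merges blocks of `x` into a single new block, and it is minimal: an interval `A`
meeting two of the merged blocks meets all of them. -/
theorem exists_rel_of_covBy {x p : Decomposition I.toClosureSystem} (h : x ⋖ p) {A : Set V}
    (hA : A ∈ I.closed) {u v : V} (hu : u ∈ A) (hv : v ∈ A) (hp : p.toSetoid u v)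
    (hx : ¬ x.toSetoid u v) {a b : V} (hpab : p.toSetoid a b) (hxab : ¬ x.toSetoid a b) :
    p.toSetoid a u ∧ ∃ c ∈ A, x.toSetoid a c := by
  let B := A ∩ {b | p.toSetoid u b}
  have hB : B ∈ I.closed := I.inter_mem hA (p.class_mem u)
  have huB : u ∈ B := ⟨hu, p.toSetoid.refl' u⟩
  have hvB : v ∈ B := ⟨hv, hp⟩
  have hle : x.merge B hB ≤ p := merge_le hB h.le fun a ha b hb =>
    p.toSetoid.trans' (p.toSetoid.symm' ha.2) hb.2
  have hlt : x < x.merge B hB := lt_of_rel (x.le_merge hB) (merge_rel_of_mem hB huB hvB) hx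
  have hEq : x.merge B hB = p := hle.eq_of_not_lt (h.2 hlt)
  rw [← hEq, merge_rel] at hpab
  obtain ⟨c, hc, hac⟩ := (hpab.resolve_left hxab).1
  exact ⟨p.toSetoid.trans' (le_iff_rel.1 h.le _ _ hac) (p.toSetoid.symm' hc.2), c, hc.1, hac⟩

/-- The form of `exists_rel_of_covBy` for a single point of the new block. -/
theorem exists_rel_of_covBy_of_rel {x p : Decomposition I.toClosureSystem} (h : x ⋖ p) {A : Set V}
    (hA : A ∈ I.closed) {u v : V} (hu : u ∈ A) (hv : v ∈ A) (hp : p.toSetoid u v)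
    (hx : ¬ x.toSetoid u v) {a : V} (ha : p.toSetoid a u) : ∃ c ∈ A, x.toSetoid a c := by
  by_cases hxa : x.toSetoid a u
  · exact ⟨u, hu, hxa⟩
  · exact (exists_rel_of_covBy h hA hu hv hp hx ha hxa).2

/-! ### Semimodularity -/

/-- If `p` covers `p ⊓ z` by merging the block `B`, then `p ⊔ z` is `z` with the blocks meeting `B`
merged. A decomposition strictly between would have a block meeting at least two of the merged blocks
inside `B`, hence, by minimality, containing all of `B`. -/
instance : IsUpperModularLattice (Decomposition I.toClosureSystem) where
  covBy_sup_of_inf_covBy {p z} h := by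
    have hxz : ∀ {a b}, (p ⊓ z).toSetoid a b → z.toSetoid a b := fun h => (inf_rel.1 h).2
    obtain ⟨a, b, hpab, hxab⟩ := exists_rel_of_lt h.lt
    have hB := p.class_mem a
    have hab : a ∈ {c | p.toSetoid a c} := p.toSetoid.refl' a
    have hpq : p ⊔ z ≤ z.merge _ hB := by
      refine sup_le (le_iff_rel.2 fun c d hcd => ?_) (z.le_merge hB)
      by_cases hx : (p ⊓ z).toSetoid c d
      · exact le_iff_rel.1 (z.le_merge hB) _ _ (hxz hx)
      · have hca := (exists_rel_of_covBy h hB hab hpab hpab hxab hcd hx).1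
        exact merge_rel_of_mem hB (p.toSetoid.symm' hca)
          (p.toSetoid.trans' (p.toSetoid.symm' hca) hcd)
    refine ⟨lt_of_le_of_ne le_sup_right fun hEq => ?_, fun y hzy hy => ?_⟩
    · exact hxab (inf_rel.2 ⟨hpab, hEq ▸ le_iff_rel.1 le_sup_left _ _ hpab⟩)
    · obtain ⟨u, v, hyuv, hzuv⟩ := exists_rel_of_lt hzy
      have hzy' := le_iff_rel.1 hzy.le
      obtain ⟨⟨u', hu', huu'⟩, v', hv', hvv'⟩ :=
        (merge_rel.1 (le_iff_rel.1 (hy.le.trans hpq) _ _ hyuv)).resolve_left hzuv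
      have hpuv : p.toSetoid u' v' := p.toSetoid.trans' (p.toSetoid.symm' hu') hv'
      have hyuv' : y.toSetoid u' v' := y.toSetoid.trans' (y.toSetoid.symm' (hzy' _ _ huu'))
        (y.toSetoid.trans' hyuv (hzy' _ _ hvv'))
      have hxuv' : ¬ (p ⊓ z).toSetoid u' v' := fun hx => hzuv
        (z.toSetoid.trans' huu' (z.toSetoid.trans' (hxz hx) (z.toSetoid.symm' hvv')))
      -- `y` already merges all of `B`.
      have key : ∀ c, p.toSetoid c u' → y.toSetoid c u' := by
        intro c hc
        obtain ⟨c', hc', hcc'⟩ := exists_rel_of_covBy_of_rel h (y.class_mem u')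
          (y.toSetoid.refl' u') hyuv' hpuv hxuv' hc
        exact y.toSetoid.trans' (hzy' _ _ (hxz hcc')) (y.toSetoid.symm' hc')
      refine hy.not_ge (sup_le (le_iff_rel.2 fun c d hcd => ?_) hzy.le)
      by_cases hx : (p ⊓ z).toSetoid c d
      · exact hzy' _ _ (hxz hx)
      · have hcu := (exists_rel_of_covBy h (y.class_mem u')
          (y.toSetoid.refl' u') hyuv' hpuv hxuv' hcd hx).1
        exact y.toSetoid.trans' (key c hcu) (y.toSetoid.symm'
          (key d (p.toSetoid.trans' (p.toSetoid.symm' hcd) hcu)))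

end Decomposition

/-! ### Lattices in which the join of covers preserves meets -/

section CoverSup

variable {L : Type*} [CompleteLattice L]

/-- The join of an element with all elements covering it. -/
def coverSup (x : L) : L :=
  sSup {p | x ⩿ p}

theorem le_coverSup_of_wcovBy {x p : L} (h : x ⩿ p) : p ≤ coverSup x :=
  le_sSup h

theorem le_coverSup (x : L) : x ≤ coverSup x :=
  le_coverSup_of_wcovBy (WCovBy.refl x)

/-- By semimodularity, a cover of `x` not below `y ≥ x` is carried to a cover of `y`. -/
theorem coverSup_mono [IsUpperModularLattice L] {x y : L} (h : x ≤ y) :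
    coverSup x ≤ coverSup y := by
  refine sSup_le fun p (hp : x ⩿ p) => ?_
  rcases hp.eq_or_eq (le_inf hp.le h) inf_le_left with hx | hx
  · rcases hp.covBy_or_eq with hc | rfl
    · exact le_sup_left.trans
        (le_coverSup_of_wcovBy (covBy_sup_of_inf_covBy_left (hx.symm ▸ hc)).wcovBy)
    · exact h.trans (le_coverSup y)
  · exact (inf_eq_left.1 hx).trans (le_coverSup y)

/-- Joins are respected because `coverSup` is monotone, meets because it preserves them. -/
theorem isGluedTolerance_coverSup [IsUpperModularLattice L]
    (hinf : ∀ x y : L, coverSup x ⊓ coverSup y ≤ coverSup (x ⊓ y)) :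
    IsGluedTolerance fun x y : L => x ⊔ y ≤ coverSup (x ⊓ y) where
  left :=
    { refl := fun a => by simpa using le_coverSup a
      symm := fun a b h => by rwa [sup_comm, inf_comm]
      sup := fun a b c d h k => by
        rw [sup_sup_sup_comm]
        exact sup_le
          (h.trans (coverSup_mono (inf_le_inf le_sup_left le_sup_left)))
          (k.trans (coverSup_mono (inf_le_inf le_sup_right le_sup_right)))
      inf := fun a b c d h k => by
        rw [inf_inf_inf_comm]
        exact le_trans (sup_le (inf_le_inf (le_sup_left.trans h) (le_sup_left.trans k))
          (inf_le_inf (le_sup_right.trans h) (le_sup_right.trans k))) (hinf _ _) }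
  right x y h := by
    change x ⊔ y ≤ coverSup (x ⊓ y)
    rw [sup_eq_right.2 h.le, inf_eq_left.2 h.le]
    exact le_coverSup_of_wcovBy h.wcovBy

theorem IsToleranceBlock.nonempty {T : L → L → Prop} (hT : IsTolerance T) {B : Set L}
    (hB : IsToleranceBlock T B) : B.Nonempty := by
  by_contra h
  rw [Set.not_nonempty_iff_eq_empty] at h
  subst h
  exact hB.2 (y := {⊥}) (by rintro x rfl y rfl; exact hT.refl _) (Set.empty_subset _) rfl

theorem IsToleranceBlock.ordConnected {T : L → L → Prop} (hT : IsTolerance T) {B : Set L}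
    (hB : IsToleranceBlock T B) : B.OrdConnected := by
  refine ⟨fun a ha b hb y hy => hB.mem_of_forall hT fun x hx => ?_⟩
  have h₁ : T y (x ⊓ y) := by
    simpa only [inf_eq_right.2 hy.2] using hT.inf _ _ y y (hB.1 b hb x hx) (hT.refl y)
  have h₂ : T y (x ⊔ y) := by
    simpa only [sup_eq_right.2 hy.1] using hT.sup _ _ y y (hB.1 a ha x hx) (hT.refl y)
  have h₃ : T (y ⊔ x) x := by
    simpa only [sup_eq_right.2 (inf_le_left : x ⊓ y ≤ x)] using hT.sup _ _ x x h₁ (hT.refl x)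
  simpa only [inf_eq_left.2 (le_sup_left : y ≤ y ⊔ x), inf_eq_right.2 (le_sup_left : x ≤ x ⊔ y)]
    using hT.inf _ _ _ _ h₂ h₃

/-- A block of the skeleton tolerance is an interval `[a, b]`, and `b ≤ coverSup a` because the
skeleton tolerance is contained in the tolerance of `isGluedTolerance_coverSup`. The hypothesis
`hsup` then writes each element of `[a, b]` as a join of covers of `a`. -/
theorem gluedByGeometricLattices_of_coverSup [Finite L] [IsUpperModularLattice L]
    (hinf : ∀ x y : L, coverSup x ⊓ coverSup y ≤ coverSup (x ⊓ y))
    (hsup : ∀ x z w : L, (∀ p, x ⩿ p → p ⊓ z ≤ w) → coverSup x ⊓ z ≤ w) :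
    GluedByGeometricLattices L := by
  intro B hB
  have hT := (isGluedTolerance_skeletonTolerance L).1
  have hconn := hB.ordConnected hT
  let S := hB.toSublattice hT
  obtain ⟨e, he⟩ := hB.nonempty hT
  have : Nonempty S := ⟨⟨e, he⟩⟩
  have := Fintype.ofFinite S
  let _ : BoundedOrder S := Fintype.toBoundedOrder S
  let c : CompleteLattice S := Fintype.toCompleteLattice S
  have hcov : ∀ {x y : S}, x ⋖ y → (x : L) ⋖ y := fun {x y} h =>
    ⟨h.1, fun z hxz hzy => h.2 (c := ⟨z, hconn.out x.2 y.2 ⟨hxz.le, hzy.le⟩⟩) hxz hzy⟩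
  refine ⟨c, rfl, ⟨fun b => ?_⟩, ⟨fun {a b} h => ?_⟩,
    CompleteLattice.isCompactlyGenerated_of_wellFoundedGT⟩
  · refine ⟨{p | p ≤ b ∧ IsAtom p}, ⟨fun p hp => hp.1, fun w hw => ?_⟩, fun p hp => hp.2⟩
    have hbot : ((⊥ : S) : L) ≤ b := bot_le (a := b)
    have hb : (b : L) ≤ coverSup ((⊥ : S) : L) := by
      have h := skeletonTolerance_le (isGluedTolerance_coverSup hinf)
        (hB.1 _ (⊥ : S).2 _ b.2)
      simpa only [sup_eq_right.2 hbot, inf_eq_left.2 hbot] using h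
    have h := hsup ((⊥ : S) : L) b w fun p hp => ?_
    · rw [inf_eq_right.2 hb] at h
      exact h
    · rcases hp.eq_or_eq (le_inf hp.le hbot) inf_le_left with hx | hx
      · rw [hx]
        exact bot_le (a := w)
      · rw [hx]
        have hpb := inf_eq_left.1 hx
        rcases hp.covBy_or_eq with hc | rfl
        · refine hw (a := ⟨p, hconn.out (⊥ : S).2 b.2 ⟨hp.le, hpb⟩⟩) ⟨hpb, ?_⟩
          exact bot_covBy_iff.1 ⟨hc.1, fun z => hc.2 (c := (z : L))⟩
        · exact bot_le (a := w)
  · have h' : (a : L) ⊓ b ⋖ a := hcov h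
    have h'' := covBy_sup_of_inf_covBy_left h'
    exact ⟨h''.1, fun z => h''.2 (c := (z : L))⟩

end CoverSup

/-! ### Meets of covers -/

namespace Decomposition

variable {V : Type*} {I : IntervalSystem V}

/-- If the block of `a` in `q ≥ x` is not a block of `x`, then some cover of `x` below `q` creates a
new relation inside that block. -/
theorem exists_covBy_rel [Finite (Decomposition I.toClosureSystem)]
    {x q : Decomposition I.toClosureSystem} (hxq : x ≤ q) {a b : V}
    (hq : q.toSetoid a b) (hx : ¬ x.toSetoid a b) :
    ∃ y u v, x ⋖ y ∧ y ≤ q ∧ y.toSetoid u v ∧ ¬ x.toSetoid u v ∧ q.toSetoid a u := by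
  have hA := q.class_mem a
  obtain ⟨y, hxy, hy⟩ := exists_covBy_le_of_lt
    (lt_of_rel (x.le_merge hA) (merge_rel_of_mem hA (q.toSetoid.refl' a) hq) hx)
  obtain ⟨u, v, hyuv, hxuv⟩ := exists_rel_of_lt hxy.lt
  obtain ⟨⟨u', hu', huu'⟩, -⟩ := (merge_rel.1 (le_iff_rel.1 hy _ _ hyuv)).resolve_left hxuv
  have hyq : y ≤ q := hy.trans (merge_le hA hxq fun c hc d hd =>
    q.toSetoid.trans' (q.toSetoid.symm' hc) hd)
  exact ⟨y, u, v, hxy, hyq, hyuv, hxuv,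
    q.toSetoid.trans' hu' (q.toSetoid.symm' (le_iff_rel.1 hxq _ _ huu'))⟩

/-- If `p` merges the block `M` over `x`, and `C` is a block of `z`, then `M ∩ C` is either one
block of `x ⊓ z` or is merged from blocks of `x ⊓ z` by a cover of `x ⊓ z`. -/
theorem covBy_inf_le_coverSup [Finite (Decomposition I.toClosureSystem)]
    {x p : Decomposition I.toClosureSystem} (h : x ⩿ p) (z : Decomposition I.toClosureSystem) :
    p ⊓ z ≤ coverSup (x ⊓ z) := by
  rcases h.covBy_or_eq with h | rfl
  swap
  · exact le_coverSup _
  rw [le_iff_rel]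
  intro a b hab
  by_cases hx : (x ⊓ z).toSetoid a b
  · exact le_iff_rel.1 (le_coverSup _) _ _ hx
  obtain ⟨y, u, v, hxy, hyq, hyuv, hxuv, hau⟩ :=
    exists_covBy_rel (inf_le_inf_right z h.le) hab hx
  refine le_iff_rel.1 (le_coverSup_of_wcovBy hxy.wcovBy) _ _ ?_
  have huv := inf_rel.1 (le_iff_rel.1 hyq _ _ hyuv)
  have hxuv' : ¬ x.toSetoid u v := fun k => hxuv (inf_rel.2 ⟨k, huv.2⟩)
  have key : ∀ c, (p ⊓ z).toSetoid c u → y.toSetoid c u := by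
    intro c hc
    obtain ⟨c', hc', hcc'⟩ := exists_rel_of_covBy_of_rel h (y.class_mem u)
      (y.toSetoid.refl' u) hyuv huv.1 hxuv' (inf_rel.1 hc).1
    have hzc' := (inf_rel.1 (le_iff_rel.1 hyq _ _ hc')).2
    have hzcc' : z.toSetoid c c' := z.toSetoid.trans' (inf_rel.1 hc).2 hzc'
    exact y.toSetoid.trans' (le_iff_rel.1 hxy.le _ _ (inf_rel.2 ⟨hcc', hzcc'⟩))
      (y.toSetoid.symm' hc')
  exact y.toSetoid.trans' (key a hau) (y.toSetoid.symm' (key b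
    ((p ⊓ z).toSetoid.trans' ((p ⊓ z).toSetoid.symm' hab) hau)))

/-- For covers on both sides. A cover `y` of `x ⊓ x'` inside a block of `p ⊓ p'` has a block meeting
every relevant block of `x` (or of `x'`), and the remaining gaps are bridged by `x ⊓ p'` (or by
`p ⊓ x'`), which `covBy_inf_le_coverSup` handles. -/
theorem inf_le_coverSup_inf [Finite (Decomposition I.toClosureSystem)]
    {x p x' p' : Decomposition I.toClosureSystem} (h : x ⩿ p) (h' : x' ⩿ p') :
    p ⊓ p' ≤ coverSup (x ⊓ x') := by
  rcases h.covBy_or_eq with hcov | rfl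
  swap
  · simpa only [inf_comm] using covBy_inf_le_coverSup h' x
  rcases h'.covBy_or_eq with hcov' | rfl
  swap
  · exact covBy_inf_le_coverSup h x'
  have hxp' : x ⊓ p' ≤ coverSup (x ⊓ x') := by
    simpa only [inf_comm] using covBy_inf_le_coverSup h' x
  have hpx' : p ⊓ x' ≤ coverSup (x ⊓ x') := covBy_inf_le_coverSup h x'
  rw [le_iff_rel]
  intro a b hab
  set s := (coverSup (x ⊓ x')).toSetoid
  by_cases hx : (x ⊓ x').toSetoid a b
  · exact le_iff_rel.1 (le_coverSup _) _ _ hx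
  obtain ⟨y, u, v, hxy, hyq, hyuv, hxuv, hau⟩ :=
    exists_covBy_rel (inf_le_inf h.le h'.le) hab hx
  have huv := inf_rel.1 (le_iff_rel.1 hyq _ _ hyuv)
  have hys := le_iff_rel.1 (le_coverSup_of_wcovBy hxy.wcovBy)
  have key : ∀ c, (p ⊓ p').toSetoid c u → s c u := by
    intro c hc
    have hc2 := inf_rel.1 hc
    by_cases hk : x.toSetoid u v
    · have hk' : ¬ x'.toSetoid u v := fun k => hxuv (inf_rel.2 ⟨hk, k⟩)
      obtain ⟨d, hd, hcd⟩ := exists_rel_of_covBy_of_rel hcov' (y.class_mem u)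
        (y.toSetoid.refl' u) hyuv huv.2 hk' hc2.2
      have hud := (inf_rel.1 (le_iff_rel.1 hyq _ _ hd)).1
      exact s.trans' (le_iff_rel.1 hpx' _ _ (inf_rel.2 ⟨p.toSetoid.trans' hc2.1 hud, hcd⟩))
        (s.symm' (hys _ _ hd))
    · obtain ⟨d, hd, hcd⟩ := exists_rel_of_covBy_of_rel hcov (y.class_mem u)
        (y.toSetoid.refl' u) hyuv huv.1 hk hc2.1
      have hud := (inf_rel.1 (le_iff_rel.1 hyq _ _ hd)).2
      exact s.trans' (le_iff_rel.1 hxp' _ _ (inf_rel.2 ⟨hcd, p'.toSetoid.trans' hc2.2 hud⟩))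
        (s.symm' (hys _ _ hd))
  exact s.trans' (key a hau) (s.symm' (key b
    ((p ⊓ p').toSetoid.trans' ((p ⊓ p').toSetoid.symm' hab) hau)))

/-! ### Meets distribute over the join of all covers -/

/-- Two points are linked over `x` if they lie in one block of `x` or of a cover of `x`. -/
def Linked (x : Decomposition I.toClosureSystem) (a b : V) : Prop :=
  ∃ p, x ⩿ p ∧ p.toSetoid a b

theorem Linked.symm {x : Decomposition I.toClosureSystem} {a b : V} (h : Linked x a b) :
    Linked x b a :=
  let ⟨p, hp, hab⟩ := h
  ⟨p, hp, p.toSetoid.symm' hab⟩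

theorem Linked.trans_rel {x : Decomposition I.toClosureSystem} {a b c : V} (h : Linked x a b)
    (hbc : x.toSetoid b c) : Linked x a c :=
  let ⟨p, hp, hab⟩ := h
  ⟨p, hp, p.toSetoid.trans' hab (le_iff_rel.1 hp.le _ _ hbc)⟩

/-- The blocks through which a path passes form an interval, since consecutive ones meet. -/
theorem exists_closed_of_path {f : ℕ → V}
    {p : ℕ → Decomposition I.toClosureSystem} {n : ℕ}
    (hp : ∀ i < n, (p i).toSetoid (f i) (f (i + 1))) :
    ∃ U ∈ I.closed, f 0 ∈ U ∧ f n ∈ U ∧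
      ∀ c ∈ U, c = f 0 ∨ ∃ i < n, (p i).toSetoid (f i) c := by
  induction n with
  | zero => exact ⟨{f 0}, I.singleton_mem _, rfl, rfl, fun c hc => Or.inl hc⟩
  | succ n ih =>
    obtain ⟨U, hU, h0, hn, h⟩ := ih fun i hi => hp i (by omega)
    refine ⟨U ∪ {c | (p n).toSetoid (f n) c}, I.union_mem _ hU _ ((p n).class_mem _)
      ⟨f n, hn, (p n).toSetoid.refl' _⟩, Or.inl h0, Or.inr (hp n (by omega)), ?_⟩
    rintro c (hc | hc)
    · rcases h c hc with h | ⟨i, hi, h⟩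
      · exact Or.inl h
      · exact Or.inr ⟨i, by omega, h⟩
    · exact Or.inr ⟨n, by omega, hc⟩

/-- A path of linked points whose ends lie in one block `D` of `z` can be replaced by one whose steps
stay inside `D`. If the path passes through `D` in between, split it there. Otherwise the union of
the blocks along the path is an interval meeting `D` in just two blocks of `x` (the two ends), so
merging these two blocks yields a cover of `x`. -/
theorem rel_of_path {x z w : Decomposition I.toClosureSystem}
    (hw : ∀ p, x ⩿ p → p ⊓ z ≤ w) (n : ℕ) (f : ℕ → V)
    (hf : ∀ i < n, Linked x (f i) (f (i + 1))) (hz : z.toSetoid (f 0) (f n)) :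
    w.toSetoid (f 0) (f n) := by
  induction n using Nat.strong_induction_on generalizing f with
  | _ n ih =>
  -- `c` is a point of `D` through which the path can be cut into two strictly shorter ones.
  by_cases hsplit : ∃ i j c, i + 2 ≤ n ∧ 2 ≤ j ∧ j ≤ n ∧ z.toSetoid (f 0) c ∧
      Linked x (f i) c ∧ Linked x c (f j)
  · obtain ⟨i, j, c, hi, hj, hjn, hzc, hic, hcj⟩ := hsplit
    have h₁ := ih (i + 1) (by omega) (fun k => if k ≤ i then f k else c) (by
      intro k hk
      rcases (Nat.lt_succ_iff.1 hk).lt_or_eq with hk | rfl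
      · simpa [hk.le, Nat.succ_le_iff.2 hk] using hf k (by omega)
      · simpa using hic) (by simpa using hzc)
    have h₂ := ih (n - j + 1) (by omega) (fun k => if k = 0 then c else f (j - 1 + k)) (by
      intro k hk
      rcases Nat.eq_zero_or_pos k with rfl | hk0
      · simpa [show j - 1 + 1 = j by omega] using hcj
      · simpa [hk0.ne', add_assoc] using hf (j - 1 + k) (by omega)) (by
      simpa [show j - 1 + (n - j + 1) = n by omega] using
        z.toSetoid.trans' (z.toSetoid.symm' hzc) hz)
    simp only [Nat.zero_le, if_true, show ¬ (i + 1 ≤ i) by omega, if_false] at h₁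
    simp only [if_true, Nat.succ_ne_zero, if_false, show j - 1 + (n - j + 1) = n by omega] at h₂
    exact w.toSetoid.trans' h₁ h₂
  have hD := z.class_mem (f 0)
  -- No block of `x` strictly inside the path meets `D`.
  have hmid : ∀ k c, 0 < k → k < n → z.toSetoid (f 0) c → ¬ x.toSetoid (f k) c := by
    intro k c hk hkn hzc hkc
    refine hsplit ⟨k - 1, k + 1, c, by omega, by omega, by omega, hzc, ?_, ?_⟩
    · have := (hf (k - 1) (by omega)).trans_rel (c := c)
      rw [show k - 1 + 1 = k by omega] at this
      exact this hkc
    · exact ((hf k hkn).symm.trans_rel hkc).symm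
  rcases Nat.lt_or_ge n 2 with hn | hn
  · interval_cases n
    · exact w.toSetoid.refl' _
    · obtain ⟨p, hp, h⟩ := hf 0 (by omega)
      exact le_iff_rel.1 (hw p hp) _ _ (inf_rel.2 ⟨h, hz⟩)
  choose! p hxp hp using hf
  obtain ⟨U, hU, hU0, hUn, hUc⟩ := exists_closed_of_path hp
  -- The first and last blocks along the path meet `D` in one block of `x` only: by minimality of a
  -- cover they would otherwise have all their blocks of `x` meet `D`, against `hmid`.
  have hend : ∀ i < n, ∀ e c, (p i).toSetoid e c → z.toSetoid (f 0) e → z.toSetoid (f 0) c →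
      (∃ k, 0 < k ∧ k < n ∧ (p i).toSetoid (f k) e) → x.toSetoid e c := by
    rintro i hi e c hec he hc ⟨k, hk0, hkn, hke⟩
    by_contra hx
    rcases (hxp i hi).covBy_or_eq with h | h
    · obtain ⟨d, hd, hkd⟩ := exists_rel_of_covBy_of_rel h hD he hc hec hx hke
      exact hmid k d hk0 hkn hd hkd
    · exact hx (h ▸ hec)
  have hG : ∀ c ∈ U, z.toSetoid (f 0) c → x.toSetoid (f 0) c ∨ x.toSetoid (f n) c := by
    intro c hc hzc
    rcases hUc c hc with rfl | ⟨i, hi, hic⟩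
    · exact Or.inl (x.toSetoid.refl' _)
    rcases Nat.eq_zero_or_pos i with rfl | hi0
    · exact Or.inl (hend 0 hi _ _ hic (z.toSetoid.refl' _) hzc
        ⟨1, by omega, by omega, (p 0).toSetoid.symm' (hp 0 hi)⟩)
    rcases (show i + 1 ≤ n from hi).lt_or_eq with hi1 | rfl
    · exact absurd ⟨i, i + 1, c, by omega, by omega, by omega, hzc, ⟨p i, hxp i hi, hic⟩,
        ⟨p i, hxp i hi, (p i).toSetoid.trans' ((p i).toSetoid.symm' hic) (hp i hi)⟩⟩ hsplit
    · exact Or.inr (hend i hi _ _ ((p i).toSetoid.trans' ((p i).toSetoid.symm' (hp i hi)) hic)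
        hz hzc ⟨i, by omega, hi, hp i hi⟩)
  have hGmem : U ∩ {c | z.toSetoid (f 0) c} ∈ I.closed := I.inter_mem hU hD
  have h0 : f 0 ∈ U ∩ {c | z.toSetoid (f 0) c} := ⟨hU0, z.toSetoid.refl' _⟩
  have hn' : f n ∈ U ∩ {c | z.toSetoid (f 0) c} := ⟨hUn, hz⟩
  -- `U ∩ D` meets just the two blocks of `x` at the ends, so merging along it gives a cover of `x`.
  refine le_iff_rel.1 (hw (x.merge _ hGmem) ⟨x.le_merge _, fun y hxy hy => ?_⟩) _ _
    (inf_rel.2 ⟨merge_rel_of_mem hGmem h0 hn', hz⟩)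
  obtain ⟨u, v, hyuv, hxuv⟩ := exists_rel_of_lt hxy
  obtain ⟨⟨u', hu', huu'⟩, v', hv', hvv'⟩ :=
    (merge_rel.1 (le_iff_rel.1 hy.le _ _ hyuv)).resolve_left hxuv
  have hxy' := le_iff_rel.1 hxy.le
  have t := fun {a b c} => x.toSetoid.trans' (x := a) (y := b) (z := c)
  have ty := fun {a b c} => y.toSetoid.trans' (x := a) (y := b) (z := c)
  have s := fun {a b} => x.toSetoid.symm' (x := a) (y := b)
  have sy := fun {a b} => y.toSetoid.symm' (x := a) (y := b)
  have h0n : y.toSetoid (f 0) (f n) := by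
    rcases hG u' hu'.1 hu'.2 with hu | hu <;> rcases hG v' hv'.1 hv'.2 with hv | hv
    · exact absurd (t huu' (t (s hu) (t hv (s hvv')))) hxuv
    · exact ty (hxy' _ _ (t hu (s huu'))) (ty hyuv (hxy' _ _ (t hvv' (s hv))))
    · exact ty (hxy' _ _ (t hv (s hvv'))) (ty (sy hyuv) (hxy' _ _ (t huu' (s hu))))
    · exact absurd (t huu' (t (s hu) (t hv (s hvv')))) hxuv
  have h0c : ∀ c ∈ U ∩ {c | z.toSetoid (f 0) c}, y.toSetoid (f 0) c := fun c hc =>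
    (hG c hc.1 hc.2).elim (hxy' _ _) fun h => ty h0n (hxy' _ _ h)
  exact hy.not_ge (merge_le hGmem hxy.le fun a ha b hb => ty (sy (h0c a ha)) (h0c b hb))

/-- The equivalence relation of being joined by a path of linked points. -/
def pathSetoid (x : Decomposition I.toClosureSystem) : Setoid V where
  r := Relation.ReflTransGen (Linked x)
  iseqv :=
    { refl := fun _ => Relation.ReflTransGen.refl
      symm := by
        have : Std.Symm (Linked x) := ⟨fun _ _ => Linked.symm⟩
        exact fun {a b} h => Relation.ReflTransGen.stdSymm.symm a b h
      trans := Relation.ReflTransGen.trans }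

theorem exists_path {x : Decomposition I.toClosureSystem} {a b : V} (h : pathSetoid x a b) :
    ∃ n, ∃ f : ℕ → V, f 0 = a ∧ f n = b ∧ ∀ i < n, Linked x (f i) (f (i + 1)) := by
  induction h with
  | refl => exact ⟨0, fun _ => a, rfl, rfl, by simp⟩
  | @tail b c _ hbc ih =>
    obtain ⟨n, f, h0, hn, hf⟩ := ih
    refine ⟨n + 1, fun k => if k ≤ n then f k else c, by simpa using h0, by simp, fun i hi => ?_⟩
    rcases (Nat.lt_succ_iff.1 hi).lt_or_eq with hi | rfl
    · simpa [hi.le, Nat.succ_le_iff.2 hi] using hf i hi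
    · simpa [hn] using hbc

theorem class_pathSetoid_mem (x : Decomposition I.toClosureSystem) (a : V) :
    {b | pathSetoid x b a} ∈ I.closed := by
  have hEq : {b | pathSetoid x b a} =
      ⋃₀ {U | U ∈ I.closed ∧ a ∈ U ∧ U ⊆ {b | pathSetoid x b a}} := by
    refine Set.Subset.antisymm (fun b hb => ?_) (Set.sUnion_subset fun U hU => hU.2.2)
    obtain ⟨n, f, rfl, rfl, hf⟩ := exists_path ((pathSetoid x).symm' hb)
    have h0 : ∀ i ≤ n, pathSetoid x (f 0) (f i) := by
      intro i hi
      induction i with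
      | zero => exact (pathSetoid x).refl' _
      | succ i ih => exact Relation.ReflTransGen.tail (ih (by omega)) (hf i (by omega))
    choose! p hxp hp using hf
    obtain ⟨U, hU, hU0, hUn, hUc⟩ := exists_closed_of_path hp
    refine ⟨U, ⟨hU, hU0, fun c hc => (pathSetoid x).symm' ?_⟩, hUn⟩
    rcases hUc c hc with rfl | ⟨i, hi, hic⟩
    · exact (pathSetoid x).refl' _
    · exact Relation.ReflTransGen.tail (h0 i hi.le) ⟨p i, hxp i hi, hic⟩
  rw [hEq]
  exact I.sUnion_mem (fun U hU => hU.1) (fun U hU => hU.2.1)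
    ⟨{a}, I.singleton_mem a, rfl, by rintro _ rfl; exact (pathSetoid x).refl' _⟩

/-- Meets distribute over the join of the covers of an element. -/
theorem coverSup_inf_le {x z w : Decomposition I.toClosureSystem}
    (hw : ∀ p, x ⩿ p → p ⊓ z ≤ w) : coverSup x ⊓ z ≤ w := by
  have hle : coverSup x ≤ ofSetoid (pathSetoid x) x.class_pathSetoid_mem := by
    refine sSup_le fun p hp => ?_
    rw [le_iff_toSetoid_le, toSetoid_ofSetoid]
    exact fun a b hab => Relation.ReflTransGen.single ⟨p, hp, hab⟩
  rw [le_iff_rel]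
  intro a b hab
  obtain ⟨hx, hz⟩ := inf_rel.1 hab
  have hpath := le_iff_rel.1 hle _ _ hx
  rw [toSetoid_ofSetoid] at hpath
  obtain ⟨n, f, rfl, rfl, hf⟩ := exists_path hpath
  exact rel_of_path hw n f hf hz

theorem coverSup_inf_coverSup_le [Finite (Decomposition I.toClosureSystem)]
    (x y : Decomposition I.toClosureSystem) : coverSup x ⊓ coverSup y ≤ coverSup (x ⊓ y) := by
  refine coverSup_inf_le fun p hp => ?_
  rw [inf_comm]
  refine coverSup_inf_le fun q hq => ?_
  rw [inf_comm]
  exact inf_le_coverSup_inf hp hq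

end Decomposition

theorem corollary3p3 {V : Type*} (I : IntervalSystem V)
    (hfin : Finite (Decomposition I.toClosureSystem)) :
    GluedByGeometricLattices (Decomposition I.toClosureSystem) :=
  gluedByGeometricLattices_of_coverSup Decomposition.coverSup_inf_coverSup_le
    fun _ _ _ => Decomposition.coverSup_inf_le
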